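/- Let $\mathbb{H}^2$ be the hyperbolic plane and write $|xy|$ for the hyperbolic distance of $x,y$. A line supports a set $C$ if it meets $C$ and $C$ lies in one of the closed half-planes bounded by the line. For a line $L$ supporting $C$, the width of $C$ determined by $L$ is the distance between $L$ and a most distant line which supports $C$ and is ultraparallel to $L$; the thickness $\Delta(C)$ is the infimum of these widths over all lines $L$ supporting $C$. Let $n\ge 3$ be odd and let $V=v_1\dots v_n$ be a convex $n$-gon in $\mathbb{H}^2$, i.e. the convex hull of $n$ points none of which lies in the convex hull of the others, the $v_i$ being its successive vertices in the positive orientation, with indices modulo $n$. Let $L_i$ be the line containing the side $v_{i+(n-1)/2}v_{i+(n+1)/2}$, and let $p_i$ be the projection of $v_i$ onto $L_i$ (the foot of the perpendicular). Assume that $V$ is an ordinary reduced polygon, that is, for every $i$ the point $p_i$ lies in the relative interior of the side $v_{i+(n-1)/2}v_{i+(n+1)/2}$ and the distance between $v_i$ and $L_i$ equals $\Delta(V)$. Then: (i) $|v_i\,p_{i+(n+1)/2}| = |p_i\,v_{i+(n+1)/2}|$ for $i=1,\dots,n$; (ii) for every $i\in\{1,\dots,n\}$ the segment $v_ip_i$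 halves the perimeter of $V$, i.e. each of the two arcs $v_iv_{i+1}\dots v_{i+(n-1)/2}\,p_i$ and $p_i\,v_{i+(n+1)/2}\dots v_{i-1}v_i$ of the boundary of $V$ has length equal to half the perimeter of $V$; (iii) put $\alpha_i=\angle v_{i+1}v_ip_i$ and $\beta_i=\angle p_iv_iv_{i+(n+1)/2}$. If $n>3$, then $\beta_i<\alpha_i$ for $i=1,\dots,n$; if $n=3$, then $\beta_i=\alpha_i$ for $i=1,\dots,n$. -/

import Mathlib

namespace HypPlane

noncomputable section

/-- The Lorentzian bilinear form `x₁y₁ + x₂y₂ - x₃y₃` on `ℝ³`. -/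
def lorentz (x y : Fin 3 → ℝ) : ℝ := x 0 * y 0 + x 1 * y 1 - x 2 * y 2

/-- The hyperbolic plane in the hyperboloid model: the upper sheet
`x₃ = √(x₁² + x₂² + 1)` of the two-sheeted hyperboloid in `ℝ³`. -/
@[ext]
structure H2 where
  coords : Fin 3 → ℝ
  mem_sheet : coords 2 = √(coords 0 ^ 2 + coords 1 ^ 2 + 1)

/-- Hyperbolic distance `|pq|`, given by `cosh |pq| = -⟨p, q⟩`. -/
def hdist (p q : H2) : ℝ := Real.arcosh (-lorentz p.coords q.coords)

/-- Distance between two sets of points (used for nonempty sets only). -/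
def setDist (A B : Set H2) : ℝ := sInf {d : ℝ | ∃ x ∈ A, ∃ y ∈ B, d = hdist x y}

/-- The orthogonal projection of `x` to the tangent plane at `b`. For `x ≠ b` this is a nonzero
tangent vector at `b` which points in the direction of the geodesic from `b` to `x`. -/
def tangentTo (b x : H2) : Fin 3 → ℝ := x.coords + lorentz x.coords b.coords • b.coords

/-- The hyperbolic angle `∠ a b c` at `b` (for `a ≠ b ≠ c`): the angle between the
tangent directions at `b` of the geodesics from `b` to `a` and from `b` to `c`. -/
def angle (a b c : H2) : ℝ :=
  Real.arccos (lorentz (tangentTo b a) (tangentTo b c) /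
    (√(lorentz (tangentTo b a) (tangentTo b a)) * √(lorentz (tangentTo b c) (tangentTo b c))))

/-- The set of points orthogonal to `u`. For spacelike `u` (that is, `⟨u, u⟩ > 0`) it is a
line, and every line is of this form. -/
def lineOf (u : Fin 3 → ℝ) : Set H2 := {x | lorentz u x.coords = 0}

/-- The line through two (different) points. -/
def lineThrough (p q : H2) : Set H2 := {x | x.coords ∈ Submodule.span ℝ {p.coords, q.coords}}

/-- The (closed) segment `pq`. -/
def seg (p q : H2) : Set H2 :=
  {x | ∃ s t : ℝ, 0 ≤ s ∧ 0 ≤ t ∧ x.coords = s • p.coords + t • q.coords}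

/-- The relative interior of the segment `pq` (for `p ≠ q`). -/
def openSeg (p q : H2) : Set H2 :=
  {x | ∃ s t : ℝ, 0 < s ∧ 0 < t ∧ x.coords = s • p.coords + t • q.coords}

/-- Hyperbolic convexity. -/
def IsConvex (C : Set H2) : Prop := ∀ p ∈ C, ∀ q ∈ C, seg p q ⊆ C

/-- The convex hull: the smallest convex set which contains `S`. -/
def hull (S : Set H2) : Set H2 := ⋂₀ {C | IsConvex C ∧ S ⊆ C}

/-- The line `L` supports `C`: it meets `C`, and `C` lies in one of the two closed half-planes
bounded by `L`. -/
def Supports (L C : Set H2) : Prop :=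
  ∃ u : Fin 3 → ℝ, 0 < lorentz u u ∧ L = lineOf u ∧
    (∀ x ∈ C, 0 ≤ lorentz u x.coords) ∧ (L ∩ C).Nonempty

/-- Perpendicular lines. -/
def Perpendicular (L M : Set H2) : Prop :=
  ∃ u w : Fin 3 → ℝ, 0 < lorentz u u ∧ 0 < lorentz w w ∧
    L = lineOf u ∧ M = lineOf w ∧ lorentz u w = 0

/-- Ultraparallel lines: disjoint lines which have a common perpendicular. -/
def Ultraparallel (L M : Set H2) : Prop :=
  Disjoint L M ∧ ∃ N, Perpendicular N L ∧ Perpendicular N M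

/-- The width of `C` determined by the supporting line `L`: the distance between `L` and
a most distant line which supports `C` and is ultraparallel to `L`. -/
def width (L C : Set H2) : ℝ :=
  sSup {d : ℝ | ∃ M, Ultraparallel L M ∧ Supports M C ∧ d = setDist L M}

/-- The thickness `Δ(C)`: the infimum of the widths of `C` over all supporting lines. -/
def thickness (C : Set H2) : ℝ := sInf {w : ℝ | ∃ L, Supports L C ∧ w = width L C}

/-- `p` is the projection of `x` onto the line `L`, i.e. the foot of the perpendicular
from `x` to `L`. -/
def IsFoot (p x : H2) (L : Set H2) : Prop :=
  p ∈ L ∧ ∀ y ∈ L, lorentz (tangentTo p x) (tangentTo p y) = 0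

/-- The point `x` lies in the closed half-plane to the left of the directed line from `p` to `q`
(the sheet being looked at from above). -/
def OnLeft (p q x : H2) : Prop := 0 ≤ Matrix.det (Matrix.of ![p.coords, q.coords, x.coords])

/-- `v` lists the vertices of a convex `n`-gon `v₁ … vₙ`, with indices modulo `n`: none of the
`n ≥ 3` points belongs to the convex hull of the remaining ones, and they are successive vertices
in the positive orientation, i.e. the convex hull of all of them lies to the left of each directed
line from `vᵢ` to `vᵢ₊₁`. -/
structure IsConvexPolygon (n : ℕ) (v : ZMod n → H2) : Prop where
  three_le : 3 ≤ n
  not_mem_hull : ∀ i, v i ∉ hull (v '' {j | j ≠ i})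
  onLeft : ∀ i, ∀ x ∈ hull (Set.range v), OnLeft (v i) (v (i + 1)) x

/-- The line `Lᵢ` which contains the side `v_{i+(n-1)/2} v_{i+(n+1)/2}` opposite to `vᵢ`. -/
def oppLine (n : ℕ) (v : ZMod n → H2) (i : ZMod n) : Set H2 :=
  lineThrough (v (i + ((n - 1) / 2 : ℕ))) (v (i + ((n + 1) / 2 : ℕ)))

/-- `v₁ … vₙ` is an ordinary reduced odd-gon: a convex `n`-gon with `n` odd such that the
projection of each `vᵢ` onto `Lᵢ` is in the relative interior of the opposite side, and the
distance between `vᵢ` and `Lᵢ` is the thickness of the polygon. -/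
structure IsOrdinaryReduced (n : ℕ) (v : ZMod n → H2) : Prop where
  convex : IsConvexPolygon n v
  odd : Odd n
  foot : ∀ i, ∃ p, IsFoot p (v i) (oppLine n v i) ∧
    p ∈ openSeg (v (i + ((n - 1) / 2 : ℕ))) (v (i + ((n + 1) / 2 : ℕ)))
  dist_eq : ∀ i, setDist {v i} (oppLine n v i) = thickness (hull (Set.range v))

/-- The length of the polygonal chain `vᵢ vᵢ₊₁ … vᵢ₊ₖ`. -/
def chainLength {n : ℕ} (v : ZMod n → H2) (i : ZMod n) (k : ℕ) : ℝ :=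
  ∑ j ∈ Finset.range k, hdist (v (i + j)) (v (i + j + 1))

/-- The perimeter of the polygon `v₁ … vₙ`. -/
def perimeter {n : ℕ} (v : ZMod n → H2) : ℝ := chainLength v 0 n

end

end HypPlane

/-! Write n = 2m+1. All heights |vᵢpᵢ| equal Δ(V). The right triangles vᵢ pᵢ vᵢ₊ₘ₊₁ and vᵢ₊ₘ₊₁
pᵢ₊ₘ₊₁ vᵢ share their hypotenuse and have equal heights as legs, so Pythagoras gives (i)
(`hdist_vertex_foot`). Put aⱼ = |vⱼ pⱼ₊ₘ₊₁|. The foot on a side cuts it into aⱼ + aⱼ₊ₘ₊₁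
(`hdist_side`), and along either arc from vᵢ to pᵢ every aⱼ occurs exactly once, which gives (ii)
(`arcs_eq`).

For n > 3 suppose αᵢ ≤ βᵢ, and let R be the reflection of q = vᵢ₊ₘ₊₁ in pᵢ. As vᵢpᵢ is perpendicular
to Lᵢ, the angle at vᵢ between pᵢ and R is βᵢ, so R is not strictly inside the line vᵢvᵢ₊₁
(`vol_reflection_nonpos`). The convex arc vᵢ … vᵢ₊ₘ pᵢ is then enclosed by the path vᵢ R pᵢ, hence
at most |vᵢR| + |Rpᵢ| = |vᵢq| + |qpᵢ| long (`convex_chain_le`). The other arc is strictly longer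
than this, since for n > 3 it has a vertex off the line vᵢq. This contradicts the equality of the
arcs.

For n = 3, Pythagoras orders the sides as the aⱼ, while the decomposition of the sides orders them
the opposite way; so all aⱼ agree and pᵢ is a midpoint. -/

namespace HypPlane

/-! ### The Lorentz form, points of the sheet, Gram determinants -/

/-- The oriented volume spanned by three vectors, `det (a, b, c)`. -/
noncomputable def vol (a b c : Fin 3 → ℝ) : ℝ :=
  a 0 * (b 1 * c 2 - b 2 * c 1) - a 1 * (b 0 * c 2 - b 2 * c 0) + a 2 * (b 0 * c 1 - b 1 * c 0)

lemma onLeft_iff (p q x : H2) : OnLeft p q x ↔ 0 ≤ vol p.coords q.coords x.coords := by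
  have : Matrix.det (Matrix.of ![p.coords, q.coords, x.coords])
      = vol p.coords q.coords x.coords := by
    rw [Matrix.det_fin_three]
    simp [vol]
    ring
  rw [OnLeft, this]

lemma lorentz_comm (x y : Fin 3 → ℝ) : lorentz x y = lorentz y x := by simp only [lorentz]; ring

lemma lorentz_add_smul_right (x y z : Fin 3 → ℝ) (s t : ℝ) :
    lorentz x (s • y + t • z) = s * lorentz x y + t * lorentz x z := by
  simp only [lorentz, Pi.add_apply, Pi.smul_apply, smul_eq_mul]; ring

lemma H2.coords_two_pos (x : H2) : 0 < x.coords 2 := by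
  rw [x.mem_sheet]; positivity

lemma H2.coords_two_sq (x : H2) : x.coords 2 ^ 2 = x.coords 0 ^ 2 + x.coords 1 ^ 2 + 1 := by
  conv_lhs => rw [x.mem_sheet]
  exact Real.sq_sqrt (by positivity)

lemma lorentz_self (x : H2) : lorentz x.coords x.coords = -1 := by
  have := x.coords_two_sq
  simp only [lorentz]; linarith

lemma one_le_neg_lorentz (x y : H2) : 1 ≤ -lorentz x.coords y.coords := by
  have hx := x.coords_two_sq
  have hy := y.coords_two_sq
  have h : (x.coords 0 * y.coords 0 + x.coords 1 * y.coords 1 + 1) ^ 2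
      ≤ (x.coords 2 * y.coords 2) ^ 2 := by
    rw [mul_pow, hx, hy]
    nlinarith [sq_nonneg (x.coords 0 - y.coords 0), sq_nonneg (x.coords 1 - y.coords 1),
      sq_nonneg (x.coords 0 * y.coords 1 - x.coords 1 * y.coords 0)]
  have := abs_le_of_sq_le_sq' h (mul_pos x.coords_two_pos y.coords_two_pos).le
  simp only [lorentz]; linarith [this.2]

lemma cosh_hdist (x y : H2) : Real.cosh (hdist x y) = -lorentz x.coords y.coords :=
  Real.cosh_arcosh (one_le_neg_lorentz x y)

lemma hdist_nonneg (x y : H2) : 0 ≤ hdist x y := Real.arcosh_nonneg (one_le_neg_lorentz x y)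

lemma hdist_comm (x y : H2) : hdist x y = hdist y x := by
  rw [hdist, hdist, lorentz_comm]

lemma hdist_eq_iff {x y z w : H2} :
    hdist x y = hdist z w ↔ lorentz x.coords y.coords = lorentz z.coords w.coords := by
  constructor
  · intro h
    have := congrArg Real.cosh h
    rw [cosh_hdist, cosh_hdist] at this
    linarith
  · intro h; rw [hdist, hdist, h]

/-- A future-directed unit timelike vector is a point of the hyperbolic plane. -/
lemma exists_coords_eq {w : Fin 3 → ℝ} (hw : lorentz w w = -1) (h2 : 0 < w 2) :
    ∃ z : H2, z.coords = w := by
  refine ⟨⟨w, ?_⟩, rfl⟩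
  symm
  rw [Real.sqrt_eq_iff_mul_self_eq (by positivity) h2.le]
  simp only [lorentz] at hw
  linarith

/-- A nonzero vector in the convex cone of two points is a positive multiple of a point. -/
lemma exists_smul_coords_eq (x y : H2) {s t : ℝ} (hs : 0 ≤ s) (ht : 0 < t) :
    ∃ z : H2, ∃ r : ℝ, 0 < r ∧ z.coords = (r * s) • x.coords + (r * t) • y.coords := by
  have hxy := one_le_neg_lorentz x y
  set N : ℝ := s ^ 2 + t ^ 2 + 2 * s * t * (-lorentz x.coords y.coords) with hN
  have hNpos : 0 < N := by
    have : 0 ≤ s * t * (-lorentz x.coords y.coords) := by positivity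
    have : 0 < t ^ 2 := by positivity
    nlinarith [sq_nonneg s]
  have hr : 0 < (√N)⁻¹ := by positivity
  have hr2 : (√N)⁻¹ ^ 2 * N = 1 := by
    rw [inv_pow, Real.sq_sqrt hNpos.le, inv_mul_cancel₀ hNpos.ne']
  obtain ⟨z, hz⟩ := exists_coords_eq
    (w := ((√N)⁻¹ * s) • x.coords + ((√N)⁻¹ * t) • y.coords) (by
      have e : lorentz (((√N)⁻¹ * s) • x.coords + ((√N)⁻¹ * t) • y.coords)
          (((√N)⁻¹ * s) • x.coords + ((√N)⁻¹ * t) • y.coords) =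
          (√N)⁻¹ ^ 2 * (s ^ 2 * lorentz x.coords x.coords + t ^ 2 * lorentz y.coords y.coords
            + 2 * s * t * lorentz x.coords y.coords) := by
        simp only [lorentz, Pi.add_apply, Pi.smul_apply, smul_eq_mul]; ring
      rw [e, lorentz_self, lorentz_self]
      rw [hN] at hr2 ⊢
      linarith)
    (by
      have := x.coords_two_pos
      have := y.coords_two_pos
      simp only [Pi.add_apply, Pi.smul_apply, smul_eq_mul]
      have h1 : 0 < (√N)⁻¹ * t * y.coords 2 := by positivity
      have h2 : 0 ≤ (√N)⁻¹ * s * x.coords 2 := by positivity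
      linarith)
  exact ⟨z, (√N)⁻¹, hr, hz⟩

/-- The Gram determinant of three points. -/
lemma vol_sq (x y z : H2) :
    vol x.coords y.coords z.coords ^ 2 =
      (lorentz x.coords y.coords ^ 2 - 1) * (lorentz y.coords z.coords ^ 2 - 1) -
        (lorentz x.coords z.coords + lorentz x.coords y.coords * lorentz y.coords z.coords) ^ 2 := by
  have hx := lorentz_self x
  have hy := lorentz_self y
  have hz := lorentz_self z
  have key : ∀ a b c : Fin 3 → ℝ, vol a b c ^ 2 =
      -(lorentz a a * lorentz b b * lorentz c c + 2 * lorentz a b * lorentz b c * lorentz a c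
        - lorentz a a * lorentz b c ^ 2 - lorentz b b * lorentz a c ^ 2
        - lorentz c c * lorentz a b ^ 2) := by
    intro a b c
    simp only [vol, lorentz]; ring
  rw [key, hx, hy, hz]; ring

/-! ### The triangle inequality and its equality case -/

lemma sinh_hdist_sq (x y : H2) : Real.sinh (hdist x y) ^ 2 = lorentz x.coords y.coords ^ 2 - 1 := by
  rw [Real.sinh_sq, cosh_hdist]; ring

/-- The Gram determinant is a square, so `vol_sq` bounds |⟨x,z⟩ + ⟨x,y⟩⟨y,z⟩| by sinh|xy| sinh|yz|;
the addition theorem for cosh does the rest. -/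
lemma neg_lorentz_le_cosh_add (x y z : H2) :
    -lorentz x.coords z.coords ≤ Real.cosh (hdist x y + hdist y z) := by
  have h := vol_sq x y z
  rw [← sinh_hdist_sq, ← sinh_hdist_sq] at h
  have h1 := Real.sinh_nonneg_iff.2 (hdist_nonneg x y)
  have h2 := Real.sinh_nonneg_iff.2 (hdist_nonneg y z)
  have h3 := abs_le_of_sq_le_sq' (a := lorentz x.coords z.coords +
    lorentz x.coords y.coords * lorentz y.coords z.coords)
    (b := Real.sinh (hdist x y) * Real.sinh (hdist y z))
    (by rw [mul_pow]; nlinarith [sq_nonneg (vol x.coords y.coords z.coords)]) (by positivity)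
  rw [Real.cosh_add, cosh_hdist, cosh_hdist]
  linarith [h3.1]

lemma hdist_triangle (x y z : H2) : hdist x z ≤ hdist x y + hdist y z := by
  have h := neg_lorentz_le_cosh_add x y z
  rw [← cosh_hdist, Real.cosh_le_cosh, abs_of_nonneg (hdist_nonneg _ _),
    abs_of_nonneg (add_nonneg (hdist_nonneg _ _) (hdist_nonneg _ _))] at h
  exact h

lemma hdist_triangle_strict {x y z : H2} (hv : vol x.coords y.coords z.coords ≠ 0) :
    hdist x z < hdist x y + hdist y z := by
  refine lt_of_le_of_ne (hdist_triangle x y z) fun h => hv ?_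
  have h1 := congrArg Real.cosh h
  rw [Real.cosh_add, cosh_hdist, cosh_hdist, cosh_hdist] at h1
  have h2 := vol_sq x y z
  rw [← sinh_hdist_sq, ← sinh_hdist_sq] at h2
  have h3 : lorentz x.coords z.coords + lorentz x.coords y.coords * lorentz y.coords z.coords =
      -(Real.sinh (hdist x y) * Real.sinh (hdist y z)) := by linarith
  rw [h3] at h2
  have : vol x.coords y.coords z.coords ^ 2 = 0 := by rw [h2]; ring
  exact pow_eq_zero_iff (two_ne_zero) |>.1 this

lemma hdist_add_of_mem_seg {x y z : H2} (h : y ∈ seg x z) :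
    hdist x y + hdist y z = hdist x z := by
  obtain ⟨s, t, hs, ht, hy⟩ := h
  have hx1 := lorentz_self x
  have hz1 := lorentz_self z
  have hy1 := lorentz_self y
  have hxy : lorentz x.coords y.coords = -s + t * lorentz x.coords z.coords := by
    rw [hy, lorentz_add_smul_right, hx1]; ring
  have hyz : lorentz y.coords z.coords = s * lorentz x.coords z.coords - t := by
    rw [lorentz_comm, hy, lorentz_add_smul_right, hz1, lorentz_comm z.coords]; ring
  have hyy : -1 = s * lorentz x.coords y.coords + t * lorentz y.coords z.coords := by
    conv_lhs => rw [← hy1]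
    conv_lhs => arg 2; rw [hy]
    rw [lorentz_add_smul_right, lorentz_comm y.coords x.coords]
  have hC := one_le_neg_lorentz x z
  set C := lorentz x.coords z.coords
  have hv : vol x.coords y.coords z.coords = 0 := by
    rw [hy]; simp only [vol, Pi.add_apply, Pi.smul_apply, smul_eq_mul]; ring
  have h2 := vol_sq x y z
  rw [hv, ← sinh_hdist_sq, ← sinh_hdist_sq] at h2
  have h1 := Real.sinh_nonneg_iff.2 (hdist_nonneg x y)
  have h1' := Real.sinh_nonneg_iff.2 (hdist_nonneg y z)
  -- The vanishing Gram determinant fixes this quantity only up to sign; the explicit form shows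
  -- that it is nonpositive.
  have hst : C + lorentz x.coords y.coords * lorentz y.coords z.coords = -(s * t * (C ^ 2 - 1)) := by
    rw [hxy, hyz] at hyy ⊢
    linear_combination -C * hyy
  have hpos : 0 ≤ s * t * (C ^ 2 - 1) := mul_nonneg (mul_nonneg hs ht) (by nlinarith)
  have heq : s * t * (C ^ 2 - 1) = Real.sinh (hdist x y) * Real.sinh (hdist y z) := by
    refine (sq_eq_sq₀ hpos (mul_nonneg h1 h1')).1 ?_
    have e : lorentz x.coords z.coords = C := rfl
    rw [e, hst] at h2
    rw [mul_pow (Real.sinh (hdist x y))]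
    linarith [neg_sq (s * t * (C ^ 2 - 1))]
  have hc : Real.cosh (hdist x y + hdist y z) = Real.cosh (hdist x z) := by
    rw [Real.cosh_add, cosh_hdist, cosh_hdist, cosh_hdist, ← heq]
    linarith
  exact Real.cosh_injOn (Set.mem_Ici.2 (add_nonneg (hdist_nonneg _ _) (hdist_nonneg _ _)))
    (Set.mem_Ici.2 (hdist_nonneg _ _)) hc

lemma openSeg_subset_seg (x y : H2) : openSeg x y ⊆ seg x y :=
  fun _ ⟨s, t, hs, ht, h⟩ => ⟨s, t, hs.le, ht.le, h⟩

lemma eq_of_lorentz_eq_neg_one {x y : H2} (h : lorentz x.coords y.coords = -1) : x = y := by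
  have hx := x.coords_two_sq
  have hy := y.coords_two_sq
  have h1 : x.coords 2 * y.coords 2 = x.coords 0 * y.coords 0 + x.coords 1 * y.coords 1 + 1 := by
    simp only [lorentz] at h; linarith
  have h2 : (x.coords 2 * y.coords 2) ^ 2 = (x.coords 0 ^ 2 + x.coords 1 ^ 2 + 1) *
      (y.coords 0 ^ 2 + y.coords 1 ^ 2 + 1) := by rw [mul_pow, hx, hy]
  rw [h1] at h2
  have h3 : (x.coords 0 - y.coords 0) ^ 2 + (x.coords 1 - y.coords 1) ^ 2
      + (x.coords 0 * y.coords 1 - x.coords 1 * y.coords 0) ^ 2 = 0 := by linarith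
  have e0 : x.coords 0 = y.coords 0 := by
    have : (x.coords 0 - y.coords 0) ^ 2 = 0 := by
      nlinarith [sq_nonneg (x.coords 0 - y.coords 0), sq_nonneg (x.coords 1 - y.coords 1),
        sq_nonneg (x.coords 0 * y.coords 1 - x.coords 1 * y.coords 0)]
    exact sub_eq_zero.1 (pow_eq_zero_iff two_ne_zero |>.1 this)
  have e1 : x.coords 1 = y.coords 1 := by
    have : (x.coords 1 - y.coords 1) ^ 2 = 0 := by
      nlinarith [sq_nonneg (x.coords 0 - y.coords 0), sq_nonneg (x.coords 1 - y.coords 1),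
        sq_nonneg (x.coords 0 * y.coords 1 - x.coords 1 * y.coords 0)]
    exact sub_eq_zero.1 (pow_eq_zero_iff two_ne_zero |>.1 this)
  ext i
  fin_cases i
  · exact e0
  · exact e1
  · change x.coords 2 = y.coords 2
    rw [x.mem_sheet, y.mem_sheet, e0, e1]

/-! ### Feet of perpendiculars -/

lemma lorentz_tangentTo (b x y : H2) : lorentz (tangentTo b x) (tangentTo b y) =
    lorentz x.coords y.coords + lorentz x.coords b.coords * lorentz b.coords y.coords := by
  have e : lorentz (tangentTo b x) (tangentTo b y) = lorentz x.coords y.coords +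
      2 * (lorentz x.coords b.coords * lorentz b.coords y.coords) +
      lorentz x.coords b.coords * lorentz b.coords y.coords * lorentz b.coords b.coords := by
    simp only [tangentTo, lorentz, Pi.add_apply, Pi.smul_apply, smul_eq_mul]; ring
  rw [e, lorentz_self]; ring

/-- Hyperbolic Pythagoras, cosh|xy| = cosh|xp| cosh|py|, for the right angle at `p`. -/
lemma IsFoot.lorentz_eq {p x : H2} {L : Set H2} (h : IsFoot p x L) {y : H2} (hy : y ∈ L) :
    lorentz x.coords y.coords = -(lorentz x.coords p.coords * lorentz p.coords y.coords) := by
  have h1 := h.2 y hy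
  rw [lorentz_tangentTo] at h1
  linarith

lemma IsFoot.unique {p q x : H2} {L : Set H2} (hp : IsFoot p x L) (hq : IsFoot q x L) : p = q := by
  have h1 := hp.lorentz_eq hq.1
  have h2 := hq.lorentz_eq hp.1
  rw [lorentz_comm q.coords] at h2
  have hx := one_le_neg_lorentz x p
  have hpq := one_le_neg_lorentz p q
  refine eq_of_lorentz_eq_neg_one ?_
  rw [h1] at h2
  have h3 : lorentz p.coords q.coords ^ 2 = 1 := by
    have : lorentz x.coords p.coords * (lorentz p.coords q.coords ^ 2 - 1) = 0 := by linarith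
    rcases mul_eq_zero.1 this with h | h <;> linarith
  nlinarith

/-- The distance from a point to a line is attained at the foot of the perpendicular. -/
lemma IsFoot.setDist_eq {p x : H2} {L : Set H2} (h : IsFoot p x L) :
    setDist {x} L = hdist x p := by
  refine IsLeast.csInf_eq ⟨⟨x, rfl, p, h.1, rfl⟩, ?_⟩
  rintro d ⟨y, hy, z, hz, rfl⟩
  obtain rfl : y = x := hy
  have h1 := h.lorentz_eq hz
  have hx := one_le_neg_lorentz y p
  have hpz := one_le_neg_lorentz p z
  refine (Real.arcosh_le_arcosh (by linarith) (by linarith [one_le_neg_lorentz y z])).2 ?_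
  nlinarith

/-! ### Betweenness, hulls and strict convexity -/

lemma left_mem_lineThrough (p q : H2) : p ∈ lineThrough p q :=
  Submodule.subset_span (by simp)

lemma right_mem_lineThrough (p q : H2) : q ∈ lineThrough p q :=
  Submodule.subset_span (by simp)

/-- Three linearly dependent points: one of them is between the other two. -/
lemma mem_seg_of_vol_eq_zero {x y z : H2} (h : vol x.coords y.coords z.coords = 0) :
    x ∈ seg y z ∨ y ∈ seg x z ∨ z ∈ seg x y := by
  obtain ⟨c, hc0, hc⟩ : ∃ c : Fin 3 → ℝ, c ≠ 0 ∧
      Matrix.vecMul c (Matrix.of ![x.coords, y.coords, z.coords]) = 0 := by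
    rw [Matrix.exists_vecMul_eq_zero_iff, Matrix.det_fin_three, ← h]
    simp [vol]; ring
  have hc' : c 0 • x.coords + c 1 • y.coords + c 2 • z.coords = 0 := by
    rw [← hc]; ext j
    simp [Matrix.vecMul, dotProduct, Fin.sum_univ_three]
  have main : ∀ (a b d : H2) (r s t : ℝ), r • a.coords + s • b.coords + t • d.coords = 0 →
      0 < r → s ≤ 0 → t ≤ 0 → a ∈ seg b d := by
    intro a b d r s t he hr hs ht
    refine ⟨-s / r, -t / r, div_nonneg (by linarith) hr.le, div_nonneg (by linarith) hr.le, ?_⟩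
    ext j
    have := congrFun he j
    simp only [Pi.add_apply, Pi.smul_apply, smul_eq_mul, Pi.zero_apply] at this ⊢
    field_simp; linarith
  have hx := x.coords_two_pos
  have hy := y.coords_two_pos
  have hz := z.coords_two_pos
  have h2 := congrFun hc' 2
  simp only [Pi.add_apply, Pi.smul_apply, smul_eq_mul, Pi.zero_apply] at h2
  have hneg : -c 0 • x.coords + -c 1 • y.coords + -c 2 • z.coords = 0 := by
    rw [← neg_eq_zero, ← hc']; module
  -- Third coordinates are positive, so the coefficients of a nontrivial relation do not all have
  -- one sign; the point whose sign stands alone is between the others.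
  rcases lt_or_ge 0 (c 0) with h0 | h0 <;> rcases lt_or_ge 0 (c 1) with h1 | h1 <;>
    rcases lt_or_ge 0 (c 2) with h3 | h3
  · linarith [mul_pos h0 hx, mul_pos h1 hy, mul_pos h3 hz]
  · have : c 2 < 0 := by nlinarith [mul_pos h0 hx, mul_pos h1 hy]
    exact Or.inr (Or.inr (main z x y (-c 2) (-c 0) (-c 1) (by rw [← hneg]; module)
      (by linarith) (by linarith) (by linarith)))
  · have : c 1 < 0 := by nlinarith [mul_pos h0 hx, mul_pos h3 hz]
    exact Or.inr (Or.inl (main y x z (-c 1) (-c 0) (-c 2) (by rw [← hneg]; module)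
      (by linarith) (by linarith) (by linarith)))
  · exact Or.inl (main x y z _ _ _ hc' h0 h1 h3)
  · have : c 0 < 0 := by nlinarith [mul_pos h1 hy, mul_pos h3 hz]
    exact Or.inl (main x y z (-c 0) (-c 1) (-c 2) hneg
      (by linarith) (by linarith) (by linarith))
  · exact Or.inr (Or.inl (main y x z (c 1) (c 0) (c 2) (by rw [← hc']; module) h1 h0 h3))
  · exact Or.inr (Or.inr (main z x y (c 2) (c 0) (c 1) (by rw [← hc']; module) h3 h0 h1))
  · refine absurd ?_ hc0
    have m0 := mul_nonpos_of_nonpos_of_nonneg h0 hx.le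
    have m1 := mul_nonpos_of_nonpos_of_nonneg h1 hy.le
    have m2 := mul_nonpos_of_nonpos_of_nonneg h3 hz.le
    have z0 : c 0 * x.coords 2 = 0 := by linarith
    have z1 : c 1 * y.coords 2 = 0 := by linarith
    have z2 : c 2 * z.coords 2 = 0 := by linarith
    ext j
    fin_cases j
    · exact (mul_eq_zero.1 z0).resolve_right hx.ne'
    · exact (mul_eq_zero.1 z1).resolve_right hy.ne'
    · exact (mul_eq_zero.1 z2).resolve_right hz.ne'

lemma subset_hull (S : Set H2) : S ⊆ hull S :=
  fun _ hx => Set.mem_sInter.2 fun _ hC => hC.2 hx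

lemma seg_subset_hull {S : Set H2} {x y : H2} (hx : x ∈ S) (hy : y ∈ S) : seg x y ⊆ hull S :=
  fun _ hz => Set.mem_sInter.2 fun _ hC => hC.1 _ (hC.2 hx) _ (hC.2 hy) hz

/-- No vertex of a convex polygon is on the line through two other successive vertices. -/
lemma IsConvexPolygon.vol_pos {n : ℕ} {v : ZMod n → H2} (hv : IsConvexPolygon n v) {i k : ZMod n}
    (hk : k ≠ i) (hk' : k ≠ i + 1) :
    0 < vol (v i).coords (v (i + 1)).coords (v k).coords := by
  have hone : i + 1 ≠ i := by
    have : Fact (1 < n) := ⟨by have := hv.three_le; omega⟩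
    simp
  refine lt_of_le_of_ne ((onLeft_iff _ _ _).1
    (hv.onLeft i _ (subset_hull _ (Set.mem_range_self k)))) fun h => ?_
  have key : ∀ a b c : ZMod n, b ≠ a → c ≠ a → v a ∉ seg (v b) (v c) := fun a b c hb hc hm =>
    hv.not_mem_hull a (seg_subset_hull (Set.mem_image_of_mem v hb) (Set.mem_image_of_mem v hc) hm)
  rcases mem_seg_of_vol_eq_zero h.symm with h | h | h
  · exact key _ _ _ hone hk h
  · exact key _ _ _ hone.symm hk' h
  · exact key _ _ _ hk.symm hk'.symm h

/-! ### Length of a convex chain against an enclosing path -/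

/-- A convex chain `x₀ x₁ … xₘ p` is not longer than the path `x₀ Y p` which goes around it, where
`xₘ` is between `p` and `Y`, and `Y` is on the outer side of the line `x₀ x₁`. -/
lemma convex_chain_le {m : ℕ} {x : ℕ → H2} {p : H2}
    (hx : ∀ a c, a ≤ m → c ≤ m + 1 → c ≠ a → c ≠ a + 1 →
      0 < vol (x a).coords (x (a + 1)).coords (x c).coords)
    (hp : p ∈ openSeg (x m) (x (m + 1))) (d : ℕ) :
    ∀ (j : ℕ) (Y : H2), j + d = m →
      (∃ r s : ℝ, 0 < r ∧ 0 ≤ s ∧ Y.coords = r • (x m).coords + (-s) • (x (m + 1)).coords) →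
      vol (x j).coords (x (j + 1)).coords Y.coords ≤ 0 →
      ∑ k ∈ Finset.range d, hdist (x (j + k)) (x (j + k + 1)) + hdist (x m) p ≤
        hdist (x j) Y + hdist Y p := by
  obtain ⟨s₁, t₁, hs₁, ht₁, hp⟩ := hp
  have between : ∀ Y : H2, (∃ r s : ℝ, 0 < r ∧ 0 ≤ s ∧
      Y.coords = r • (x m).coords + (-s) • (x (m + 1)).coords) → x m ∈ seg p Y := by
    rintro Y ⟨r, s, hr, hs, hY⟩
    have hpos : 0 < r * t₁ + s * s₁ := by positivity
    refine ⟨s / (r * t₁ + s * s₁), t₁ / (r * t₁ + s * s₁), by positivity, by positivity, ?_⟩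
    rw [hp, hY]
    ext i
    simp only [Pi.add_apply, Pi.smul_apply, smul_eq_mul]
    field_simp
    ring
  induction d with
  | zero =>
    intro j Y hj _ _
    obtain rfl : j = m := hj
    simpa using hdist_triangle (x j) Y p
  | succ d ih =>
    intro j Y hj hY hvol
    have hb := between Y hY
    -- The last edge is separate: there `x (j + 1) = x m`, and the volume `F` below would vanish.
    rcases Nat.eq_zero_or_pos d with rfl | hd
    · obtain rfl : j + 1 = m := hj
      have h1 := hdist_add_of_mem_seg hb
      have h2 := hdist_triangle (x j) Y (x (j + 1))
      rw [hdist_comm Y (x (j + 1))] at h2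
      rw [hdist_comm p Y, hdist_comm p] at h1
      simp
      linarith
    obtain ⟨r, s, hr, hs, hYc⟩ := hY
    have hF := hx j m (by omega) (by omega) (by omega) (by omega)
    have hQ := hx j (m + 1) (by omega) (by omega) (by omega) (by omega)
    set F := vol (x j).coords (x (j + 1)).coords (x m).coords
    set G := vol (x j).coords (x (j + 1)).coords Y.coords with hG
    -- `Z` is where the line through `x j` and `x (j + 1)` meets the segment from `x m` to `Y`: the
    -- weights cancel the values `F` and `G` of the volume at its ends. Cutting the path off at `Z`
    -- does not lengthen it, and the induction goes on from `x (j + 1)` with `Z` as `Y`.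
    obtain ⟨Z, e, he, hZ⟩ := exists_smul_coords_eq (x m) Y (s := -G) (t := F) (by linarith) hF
    have hZY : ∃ r s : ℝ, 0 < r ∧ 0 ≤ s ∧
        Z.coords = r • (x m).coords + (-s) • (x (m + 1)).coords := by
      have hG0 : 0 ≤ -G := by linarith
      refine ⟨e * -G + e * F * r, e * F * s, by positivity, by positivity, ?_⟩
      rw [hZ, hYc]; module
    have hZf : vol (x j).coords (x (j + 1)).coords Z.coords = 0 := by
      have : vol (x j).coords (x (j + 1)).coords Z.coords = e * -G * F + e * F * G := by
        rw [hZ, hG]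
        simp only [F, vol, Pi.add_apply, Pi.smul_apply, smul_eq_mul]; ring
      rw [this]; ring
    have hZp : Z ∈ seg p Y := by
      obtain ⟨a, b, ha, hb, hm⟩ := hb
      have hG0 : 0 ≤ -G := by linarith
      refine ⟨e * -G * a, e * -G * b + e * F, by positivity, by positivity, ?_⟩
      rw [hZ]
      nth_rewrite 1 [hm]
      module
    obtain ⟨r', s', hr', hs', hZc⟩ := id hZY
    have hvolZ : ∀ a : H2, vol a.coords Z.coords (x (m + 1)).coords =
        r' * vol (x m).coords (x (m + 1)).coords a.coords := by
      intro a
      rw [hZc]; simp only [vol, Pi.add_apply, Pi.smul_apply, smul_eq_mul]; ring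
    have hA : 0 < vol (x j).coords Z.coords (x (m + 1)).coords := by
      rw [hvolZ]; exact mul_pos hr' (hx m j le_rfl (by omega) (by omega) (by omega))
    have hB : 0 < vol (x (j + 1)).coords Z.coords (x (m + 1)).coords := by
      rw [hvolZ]; exact mul_pos hr' (hx m (j + 1) le_rfl (by omega) (by omega) (by omega))
    -- Cramer's relation among four vectors; the coefficient of `x (m + 1)` vanishes by `hZf`, and
    -- the signs `hA`, `hB`, `hQ` put `x (j + 1)` between `x j` and `Z`.
    have hcramer : ∀ i, vol (x j).coords Z.coords (x (m + 1)).coords * (x (j + 1)).coords i =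
        vol (x (j + 1)).coords Z.coords (x (m + 1)).coords * (x j).coords i +
        vol (x j).coords (x (j + 1)).coords (x (m + 1)).coords * Z.coords i := by
      intro i
      have : vol (x j).coords Z.coords (x (m + 1)).coords * (x (j + 1)).coords i =
        vol (x (j + 1)).coords Z.coords (x (m + 1)).coords * (x j).coords i +
        vol (x j).coords (x (j + 1)).coords (x (m + 1)).coords * Z.coords i
        - vol (x j).coords (x (j + 1)).coords Z.coords * (x (m + 1)).coords i := by
        fin_cases i <;> simp only [vol, Fin.zero_eta, Fin.mk_one, Fin.reduceFinMk] <;> ring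
      rw [this, hZf]; ring
    have hseg : x (j + 1) ∈ seg (x j) Z := by
      refine ⟨vol (x (j + 1)).coords Z.coords (x (m + 1)).coords /
        vol (x j).coords Z.coords (x (m + 1)).coords,
        vol (x j).coords (x (j + 1)).coords (x (m + 1)).coords /
        vol (x j).coords Z.coords (x (m + 1)).coords, by positivity, by positivity, ?_⟩
      ext i
      have := hcramer i
      simp only [Pi.add_apply, Pi.smul_apply, smul_eq_mul]
      field_simp
      linarith
    -- The line of the next edge passes through `x (j + 1)`, with `x j` on its left, so `Z` is on
    -- its right.
    have hnext : vol (x (j + 1)).coords (x (j + 1 + 1)).coords Z.coords ≤ 0 := by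
      have h0 := hx (j + 1) j (by omega) (by omega) (by omega) (by omega)
      have h1 : vol (x j).coords Z.coords (x (m + 1)).coords * 0 =
        vol (x (j + 1)).coords Z.coords (x (m + 1)).coords *
          vol (x (j + 1)).coords (x (j + 1 + 1)).coords (x j).coords +
        vol (x j).coords (x (j + 1)).coords (x (m + 1)).coords *
          vol (x (j + 1)).coords (x (j + 1 + 1)).coords Z.coords := by
        have e0 := hcramer 0
        have e1 := hcramer 1
        have e2 := hcramer 2
        have hlin : ∀ b w : Fin 3 → ℝ, vol (x (j + 1)).coords b w =
          ((x (j + 1)).coords 1 * b 2 - (x (j + 1)).coords 2 * b 1) * w 0 +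
          ((x (j + 1)).coords 2 * b 0 - (x (j + 1)).coords 0 * b 2) * w 1 +
          ((x (j + 1)).coords 0 * b 1 - (x (j + 1)).coords 1 * b 0) * w 2 := by
          intro b w; simp only [vol]; ring
        generalize vol (x j).coords Z.coords (x (m + 1)).coords = A at *
        generalize vol (x (j + 1)).coords Z.coords (x (m + 1)).coords = B at *
        generalize vol (x j).coords (x (j + 1)).coords (x (m + 1)).coords = C at *
        rw [hlin _ (x j).coords, hlin _ Z.coords]
        linear_combination ((x (j + 1)).coords 1 * (x (j + 1 + 1)).coords 2 -
          (x (j + 1)).coords 2 * (x (j + 1 + 1)).coords 1) * e0 +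
          ((x (j + 1)).coords 2 * (x (j + 1 + 1)).coords 0 -
          (x (j + 1)).coords 0 * (x (j + 1 + 1)).coords 2) * e1 +
          ((x (j + 1)).coords 0 * (x (j + 1 + 1)).coords 1 -
          (x (j + 1)).coords 1 * (x (j + 1 + 1)).coords 0) * e2
      by_contra! hcon
      have := mul_pos hB h0
      have := mul_pos hQ hcon
      linarith
    have hfin := ih (j + 1) Z (by omega) hZY hnext
    have d1 := hdist_add_of_mem_seg hseg
    have d2 := hdist_add_of_mem_seg hZp
    have d3 := hdist_triangle (x j) Y Z
    rw [hdist_comm Y Z] at d3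
    rw [hdist_comm p Z, hdist_comm p Y] at d2
    rw [Finset.sum_range_succ']
    have hsum : ∑ k ∈ Finset.range d, hdist (x (j + (k + 1))) (x (j + (k + 1) + 1)) =
        ∑ k ∈ Finset.range d, hdist (x (j + 1 + k)) (x (j + 1 + k + 1)) :=
      Finset.sum_congr rfl fun k _ => by rw [show j + (k + 1) = j + 1 + k by omega]
    rw [hsum, add_zero]
    linarith

/-! ### Point reflection and comparison of angles -/

/-- The reflection of `q` in the point `p`. -/
lemma exists_reflection (p q : H2) :
    ∃ z : H2, z.coords = (-2 * lorentz p.coords q.coords) • p.coords + (-1 : ℝ) • q.coords := by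
  set C := lorentz p.coords q.coords
  set w : Fin 3 → ℝ := (-2 * C) • p.coords + (-1 : ℝ) • q.coords with hw
  have hC : 1 ≤ -C := one_le_neg_lorentz p q
  have hpw : lorentz p.coords w = C := by
    rw [hw, lorentz_add_smul_right, lorentz_self]; ring
  have hqw : lorentz q.coords w = -2 * C ^ 2 + 1 := by
    rw [hw, lorentz_add_smul_right, lorentz_self, lorentz_comm q.coords]; ring
  have hww : lorentz w w = -1 := by
    have : lorentz w w = (-2 * C) * lorentz w p.coords + -1 * lorentz w q.coords := by
      conv_lhs => arg 2; rw [hw]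
      rw [lorentz_add_smul_right]
    rw [this, lorentz_comm w, lorentz_comm w, hpw, hqw]; ring
  refine exists_coords_eq hww ?_
  -- On the lower sheet, `-w` would be a point whose distance from `p` has the cosh `C ≤ -1`.
  by_contra! h
  have hne : w 2 ≠ 0 := by
    intro h0
    simp only [lorentz, h0] at hww
    nlinarith [sq_nonneg (w 0), sq_nonneg (w 1)]
  obtain ⟨z, hz⟩ := exists_coords_eq (w := -w)
    (by rw [← hww]; simp only [lorentz, Pi.neg_apply]; ring)
    (by simpa using lt_of_le_of_ne h hne)
  have h1 := one_le_neg_lorentz p z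
  have h2 : lorentz p.coords z.coords = -C := by
    rw [hz, ← hpw]; simp only [lorentz, Pi.neg_apply]; ring
  linarith

lemma angle_eq_arccos (a b c : H2) : angle a b c =
    Real.arccos ((lorentz a.coords c.coords + lorentz a.coords b.coords * lorentz b.coords c.coords) /
      (√(lorentz a.coords b.coords ^ 2 - 1) * √(lorentz b.coords c.coords ^ 2 - 1))) := by
  rw [angle, lorentz_tangentTo, lorentz_tangentTo, lorentz_tangentTo, lorentz_self, lorentz_self,
    lorentz_comm b.coords a.coords, lorentz_comm c.coords b.coords]
  ring_nf

lemma angle_comm (a b c : H2) : angle a b c = angle c b a := by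
  rw [angle, angle, lorentz_comm (tangentTo b a) (tangentTo b c), mul_comm (√_)]

/-- The sine rule of subtraction at a vertex, in terms of oriented volumes. -/
lemma vol_mul_eq (v x r p : H2) :
    (lorentz p.coords v.coords ^ 2 - 1) * vol v.coords x.coords r.coords =
      vol v.coords x.coords p.coords * (lorentz r.coords p.coords +
        lorentz r.coords v.coords * lorentz v.coords p.coords) -
      (lorentz x.coords p.coords + lorentz x.coords v.coords * lorentz v.coords p.coords) *
        vol v.coords r.coords p.coords := by
  have key : ∀ a b c d : Fin 3 → ℝ,
      (lorentz a a * lorentz d d - lorentz d a ^ 2) * vol a b c =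
        vol a b d * (lorentz a a * lorentz c d - lorentz c a * lorentz a d) -
        (lorentz a a * lorentz b d - lorentz b a * lorentz a d) * vol a c d := by
    intro a b c d
    simp only [vol, lorentz]; ring
  have h := key v.coords x.coords r.coords p.coords
  rw [lorentz_self, lorentz_self] at h
  linear_combination -h

/-- Let `v p q` be a right triangle with the right angle at `p`, and let `r` be the reflection of
`q` in `p`. If the angle `x v p` is at most `p v q`, then `r` is not inside the angle `x v p`. -/
lemma vol_reflection_nonpos {v x p q r : H2}
    (hr : r.coords = (-2 * lorentz p.coords q.coords) • p.coords + (-1 : ℝ) • q.coords)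
    (hright : lorentz v.coords q.coords = -(lorentz v.coords p.coords * lorentz p.coords q.coords))
    (hx : 0 < vol v.coords x.coords p.coords) (hq : 0 < vol v.coords p.coords q.coords)
    (hangle : angle x v p ≤ angle p v q) :
    vol v.coords x.coords r.coords ≤ 0 := by
  have hC := one_le_neg_lorentz p q
  have swap : ∀ a b c : Fin 3 → ℝ, vol b a c = -vol a b c := by
    intro a b c; simp only [vol]; ring
  have g1 := vol_sq x v p
  have g2 := vol_sq p v q
  rw [swap v.coords, neg_sq] at g1 g2
  rw [angle_eq_arccos, angle_eq_arccos] at hangle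
  have hmul := vol_mul_eq v x r p
  have hvr : vol v.coords r.coords p.coords = vol v.coords p.coords q.coords := by
    rw [hr]; simp only [vol, Pi.add_apply, Pi.smul_apply, smul_eq_mul]; ring
  have hrp : lorentz r.coords p.coords = lorentz p.coords q.coords := by
    rw [lorentz_comm, hr, lorentz_add_smul_right, lorentz_self]; ring
  have hrv : lorentz r.coords v.coords = lorentz v.coords q.coords := by
    rw [lorentz_comm, hr, lorentz_add_smul_right, hright]; ring
  rw [hvr, hrp, hrv] at hmul
  rw [lorentz_comm p.coords v.coords] at hangle g2 hmul
  -- The `N` are squared sinh of distances from `v`; the `c` and `σ` are products of two such sinh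
  -- with the cosine and the sine of the angle at `v`.
  set NX := lorentz x.coords v.coords ^ 2 - 1 with hNX
  set NP := lorentz v.coords p.coords ^ 2 - 1 with hNP
  set NQ := lorentz v.coords q.coords ^ 2 - 1 with hNQ
  set cX := lorentz x.coords p.coords + lorentz x.coords v.coords * lorentz v.coords p.coords
  have hcQ : lorentz p.coords q.coords + lorentz v.coords p.coords * lorentz v.coords q.coords =
      -lorentz p.coords q.coords * NP := by
    rw [hright, hNP]; ring
  have hcQ' : lorentz p.coords q.coords + lorentz v.coords q.coords * lorentz v.coords p.coords =
      -lorentz p.coords q.coords * NP := by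
    rw [← hcQ]; ring
  rw [hcQ] at hangle g2
  rw [hcQ'] at hmul
  set σX := vol v.coords x.coords p.coords
  set σQ := vol v.coords p.coords q.coords
  have nn : ∀ a b : H2, 0 ≤ lorentz a.coords b.coords ^ 2 - 1 := fun a b => by
    nlinarith [one_le_neg_lorentz a b]
  have hσX : 0 < σX ^ 2 := by positivity
  have hσQ : 0 < σQ ^ 2 := by positivity
  have hP : 0 < NP := by
    refine lt_of_le_of_ne (nn v p) fun h => ?_
    rw [← h] at g1; nlinarith [sq_nonneg cX]
  have hX : 0 < NX := by
    refine lt_of_le_of_ne (nn x v) fun h => ?_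
    rw [← h] at g1; nlinarith [sq_nonneg cX]
  have hQ : 0 < NQ := by
    refine lt_of_le_of_ne (nn v q) fun h => ?_
    rw [← h] at g2; nlinarith [sq_nonneg (-lorentz p.coords q.coords * NP)]
  set cQ := -lorentz p.coords q.coords * NP with hcQdef
  have hcQpos : 0 < cQ := mul_pos (by linarith) hP
  clear_value cQ
  have sX : 0 < √NX := Real.sqrt_pos.2 hX
  have sP : 0 < √NP := Real.sqrt_pos.2 hP
  have sQ : 0 < √NQ := Real.sqrt_pos.2 hQ
  have qX := Real.sq_sqrt hX.le
  have qP := Real.sq_sqrt hP.le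
  have qQ := Real.sq_sqrt hQ.le
  -- `Real.arccos` is constant outside [-1, 1], so both quotients have to be bounded before angles
  -- can be turned into cosines.
  have hle : cQ / (√NP * √NQ) ≤ cX / (√NX * √NP) := by
    by_contra! hlt
    have b1 : -1 ≤ cX / (√NX * √NP) := by
      rw [le_div_iff₀ (by positivity)]
      have : cX ^ 2 ≤ (√NX * √NP) ^ 2 := by rw [mul_pow, qX, qP]; linarith
      linarith [(abs_le_of_sq_le_sq' this (by positivity)).1]
    have b2 : cQ / (√NP * √NQ) ≤ 1 := by
      rw [div_le_one (by positivity)]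
      have : cQ ^ 2 ≤ (√NP * √NQ) ^ 2 := by rw [mul_pow, qQ, qP]; linarith
      linarith [(abs_le_of_sq_le_sq' this (by positivity)).2]
    have := Real.strictAntiOn_arccos ⟨b1, hlt.le.trans b2⟩ ⟨b1.trans hlt.le, b2⟩ hlt
    linarith
  have hle2 : cQ * √NX ≤ cX * √NQ := by
    rw [div_le_div_iff₀ (by positivity) (by positivity)] at hle
    have : (cQ * √NX) * √NP ≤ (cX * √NQ) * √NP := by linarith
    exact le_of_mul_le_mul_right this sP
  have hcX : 0 < cX := by
    by_contra! h
    have := mul_pos hcQpos sX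
    have := mul_nonpos_of_nonpos_of_nonneg h sQ.le
    linarith
  have hle3 : cQ ^ 2 * NX ≤ cX ^ 2 * NQ := by
    have := pow_le_pow_left₀ (by positivity) hle2 2
    rwa [mul_pow, mul_pow, qX, qQ] at this
  -- This is tan α ≤ tan β for two acute angles, from cos β ≤ cos α and sin² + cos² = 1 in the form
  -- `g1`, `g2`.
  have hfin : σX * cQ ≤ cX * σQ := by
    refine le_of_sq_le_sq ?_ (by positivity)
    rw [mul_pow, mul_pow, g1, g2]
    linarith [mul_le_mul_of_nonneg_left hle3 hP.le]
  by_contra! h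
  have := mul_pos hP h
  linarith

/-! ### Lengths of boundary chains -/

lemma chainLength_add {n : ℕ} (v : ZMod n → H2) (i : ZMod n) (k l : ℕ) :
    chainLength v i (k + l) = chainLength v i k + chainLength v (i + k) l := by
  rw [chainLength, Finset.sum_range_add]
  congr 1
  refine Finset.sum_congr rfl fun j _ => ?_
  push_cast
  simp only [add_assoc]

lemma chainLength_one {n : ℕ} (v : ZMod n → H2) (i : ZMod n) :
    chainLength v i 1 = hdist (v i) (v (i + 1)) := by
  simp [chainLength]

lemma hdist_le_chainLength {n : ℕ} (v : ZMod n → H2) (i : ZMod n) (k : ℕ) :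
    hdist (v i) (v (i + k)) ≤ chainLength v i k := by
  induction k with
  | zero =>
    have : hdist (v i) (v i) = 0 := by
      have h := Real.arcosh_zero
      rw [hdist, lorentz_self, neg_neg, h]
    simp [chainLength, this]
  | succ k ih =>
    rw [chainLength_add, chainLength_one]
    have := hdist_triangle (v i) (v (i + k)) (v (i + k + 1))
    push_cast
    rw [← add_assoc]
    linarith

lemma chainLength_self {n : ℕ} [NeZero n] (v : ZMod n → H2) (i : ZMod n) :
    chainLength v i n = perimeter v := by
  -- Moving the start by one trades the first edge for the edge n places later, which is the same
  -- edge.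
  have step : ∀ i : ZMod n, chainLength v (i + 1) n = chainLength v i n := by
    intro i
    have h1 := chainLength_add v i n 1
    have h2 := chainLength_add v i 1 n
    rw [add_comm 1 n, h1, chainLength_one, chainLength_one, ZMod.natCast_self, add_zero,
      Nat.cast_one] at h2
    linarith
  have all : ∀ k : ℕ, chainLength v (k : ZMod n) n = perimeter v := by
    intro k
    induction k with
    | zero => rw [perimeter, Nat.cast_zero]
    | succ k ih => rw [Nat.cast_succ, step, ih]
  rw [← ZMod.natCast_zmod_val i]
  exact all _

/-! ### Ordinary reduced polygons with 2m+1 vertices -/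

section Odd

variable {m : ℕ} {v p : ZMod (2 * m + 1) → H2}

lemma natCast_two_mul_add_one (m : ℕ) : (2 * m + 1 : ZMod (2 * m + 1)) = 0 := by
  exact_mod_cast ZMod.natCast_self (2 * m + 1)

lemma natCast_ne {n a b : ℕ} (ha : a < n) (hb : b < n) (hab : a ≠ b) :
    (a : ZMod n) ≠ b := by
  rw [Ne, ZMod.natCast_eq_natCast_iff', Nat.mod_eq_of_lt ha, Nat.mod_eq_of_lt hb]
  exact hab

lemma oppLine_eq (v : ZMod (2 * m + 1) → H2) (i : ZMod (2 * m + 1)) :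
    oppLine (2 * m + 1) v i = lineThrough (v (i + m)) (v (i + m + 1)) := by
  rw [oppLine, show (2 * m + 1 - 1) / 2 = m by omega, show (2 * m + 1 + 1) / 2 = m + 1 by omega,
    Nat.cast_succ, add_assoc]

lemma left_mem_oppLine (v : ZMod (2 * m + 1) → H2) (i : ZMod (2 * m + 1)) :
    v (i + m) ∈ oppLine (2 * m + 1) v i := by
  rw [oppLine_eq]; exact left_mem_lineThrough _ _

lemma right_mem_oppLine (v : ZMod (2 * m + 1) → H2) (i : ZMod (2 * m + 1)) :
    v (i + m + 1) ∈ oppLine (2 * m + 1) v i := by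
  rw [oppLine_eq]; exact right_mem_lineThrough _ _

variable (hv : IsOrdinaryReduced (2 * m + 1) v)
  (hp : ∀ i, IsFoot (p i) (v i) (oppLine (2 * m + 1) v i))

include hv hp

lemma foot_mem_openSeg (i : ZMod (2 * m + 1)) : p i ∈ openSeg (v (i + m)) (v (i + m + 1)) := by
  obtain ⟨q, hq, hqs⟩ := hv.foot i
  rw [(hp i).unique hq]
  rwa [show (2 * m + 1 - 1) / 2 = m by omega, show (2 * m + 1 + 1) / 2 = m + 1 by omega,
    Nat.cast_succ, ← add_assoc] at hqs

lemma height_eq (i j : ZMod (2 * m + 1)) :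
    lorentz (v i).coords (p i).coords = lorentz (v j).coords (p j).coords := by
  rw [← hdist_eq_iff, ← (hp i).setDist_eq, ← (hp j).setDist_eq, hv.dist_eq, hv.dist_eq]

/-- The right triangles `vᵢ pᵢ vᵢ₊ₘ₊₁` and `vᵢ₊ₘ₊₁ pᵢ₊ₘ₊₁ vᵢ` have the same hypotenuse and equal
heights as legs, so that their other legs are equal too. -/
lemma hdist_vertex_foot (i : ZMod (2 * m + 1)) :
    hdist (v i) (p (i + m + 1)) = hdist (p i) (v (i + m + 1)) := by
  have hz := natCast_two_mul_add_one m
  have h1 := (hp i).lorentz_eq (right_mem_oppLine v i)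
  have h2 := (hp (i + m + 1)).lorentz_eq (left_mem_oppLine v (i + m + 1))
  rw [show i + m + 1 + (m : ZMod (2 * m + 1)) = i by linear_combination hz,
    height_eq hv hp (i + m + 1) i, lorentz_comm, h1] at h2
  have h3 := one_le_neg_lorentz (v i) (p i)
  rw [hdist_eq_iff, lorentz_comm]
  exact (mul_left_cancel₀ (by linarith) (neg_injective h2)).symm

/-- This side is opposite to vᵢ₊ₘ₊₁, because 2m+1 = 0 in the index ring. Its foot cuts it in two,
and (i) rewrites the second part. -/
lemma hdist_side (i : ZMod (2 * m + 1)) :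
    hdist (v i) (v (i + 1)) = hdist (v i) (p (i + m + 1)) + hdist (v (i + m + 1)) (p (i + 1)) := by
  have hz := natCast_two_mul_add_one m
  have h := hdist_add_of_mem_seg (openSeg_subset_seg _ _ (foot_mem_openSeg hv hp (i + m + 1)))
  have h1 := hdist_vertex_foot hv hp (i + m + 1)
  rw [show i + m + 1 + (m : ZMod (2 * m + 1)) = i by linear_combination hz] at h h1
  rw [← h, ← h1]

/-- The segment from a vertex to its foot halves the perimeter. -/
lemma arcs_eq (i : ZMod (2 * m + 1)) :
    chainLength v i m + hdist (v (i + m)) (p i) =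
      hdist (p i) (v (i + m + 1)) + chainLength v (i + m + 1) m := by
  have hz := natCast_two_mul_add_one m
  set a : ZMod (2 * m + 1) → ℝ := fun j => hdist (v j) (p (j + m + 1)) with ha
  have hs : ∀ j, hdist (v j) (v (j + 1)) = a j + a (j + m + 1) := by
    intro j
    rw [hdist_side hv hp, ha]
    simp only
    rw [show j + m + 1 + m + 1 = j + 1 by linear_combination hz]
  have h0 : hdist (v (i + m)) (p i) = a (i + m) := by
    rw [ha]; simp only
    rw [show i + m + m + 1 = i by linear_combination hz]
  have e1 : chainLength v i m = ∑ j ∈ Finset.range m, a (i + j) +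
      ∑ j ∈ Finset.range m, a (i + m + 1 + j) := by
    rw [chainLength, ← Finset.sum_add_distrib]
    refine Finset.sum_congr rfl fun j _ => ?_
    rw [hs, show i + (j : ZMod (2 * m + 1)) + m + 1 = i + m + 1 + j by ring]
  have e2 : chainLength v (i + m + 1) m = ∑ j ∈ Finset.range m, a (i + m + 1 + j) +
      ∑ j ∈ Finset.range m, a (i + (j + 1 : ℕ)) := by
    rw [chainLength, ← Finset.sum_add_distrib]
    refine Finset.sum_congr rfl fun j _ => ?_
    rw [hs, show i + m + 1 + (j : ZMod (2 * m + 1)) + m + 1 = i + (j + 1 : ℕ) by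
      push_cast; linear_combination hz]
  -- The m+1 terms aᵢ, …, aᵢ₊ₘ are split at either end: one arc is missing the last of them, the
  -- other the first, and the half-sides at pᵢ supply these.
  have e3 := Finset.sum_range_succ (fun j : ℕ => a (i + j)) m
  rw [Finset.sum_range_succ', Nat.cast_zero, add_zero] at e3
  rw [h0, e1, e2, ← hdist_vertex_foot hv hp]
  change _ = a i + _
  linarith

lemma arcs_add (i : ZMod (2 * m + 1)) :
    (chainLength v i m + hdist (v (i + m)) (p i)) +
      (hdist (p i) (v (i + m + 1)) + chainLength v (i + m + 1) m) = perimeter v := by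
  have h := hdist_add_of_mem_seg (openSeg_subset_seg _ _ (foot_mem_openSeg hv hp i))
  have hlen : chainLength v i (2 * m + 1) = chainLength v i (m + (1 + m)) :=
    congrArg (chainLength v i) (by ring)
  rw [← chainLength_self v i, hlen, chainLength_add, chainLength_add, chainLength_one, ← h,
    Nat.cast_one]
  ring

lemma angle_lt_angle (hm : 2 ≤ m) (i : ZMod (2 * m + 1)) :
    angle (p i) (v i) (v (i + m + 1)) < angle (v (i + 1)) (v i) (p i) := by
  by_contra! hangle
  have hz := natCast_two_mul_add_one m
  set x : ℕ → H2 := fun a => v (i + a) with hx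
  have hx0 : x 0 = v i := by simp [hx]
  have hx1 : x (0 + 1) = v (i + 1) := by simp [hx]
  have hxm : x (m + 1) = v (i + m + 1) := by simp [hx, add_assoc]
  -- The case `a = m + 1`, used only for the strict inequality at the end, involves the vertex of
  -- index m+2, which differs from vᵢ because m ≥ 2.
  have hpos : ∀ a c, a ≤ m + 1 → c ≤ m + 1 → c ≠ a → c ≠ a + 1 →
      0 < vol (x a).coords (x (a + 1)).coords (x c).coords := by
    intro a c ha hc h1 h2
    have n1 := natCast_ne (n := 2 * m + 1) (a := c) (b := a) (by omega) (by omega) h1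
    have n2 := natCast_ne (n := 2 * m + 1) (a := c) (b := a + 1) (by omega) (by omega) h2
    have := hv.convex.vol_pos (i := i + a) (k := i + c) (by simpa using n1)
      (by rw [add_assoc]; push_cast at n2; simpa using n2)
    simpa [hx, add_assoc] using this
  have hseg : p i ∈ openSeg (x m) (x (m + 1)) := by
    rw [hxm]; exact foot_mem_openSeg hv hp i
  obtain ⟨s, t, hs, ht, hps⟩ := id hseg
  obtain ⟨R, hR⟩ := exists_reflection (p i) (x (m + 1))
  have hC := one_le_neg_lorentz (p i) (x (m + 1))
  have hright := (hp i).lorentz_eq (right_mem_oppLine v i)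
  rw [← hxm, ← hx0] at hright
  have f1 := hpos 0 m (by omega) (by omega) (by omega) (by omega)
  have f2 := hpos 0 (m + 1) (by omega) (by omega) (by omega) (by omega)
  have f3 := hpos m 0 (by omega) (by omega) (by omega) (by omega)
  have hvol : vol (x 0).coords (x (0 + 1)).coords R.coords ≤ 0 := by
    refine vol_reflection_nonpos hR hright ?_ ?_ ?_
    · have : vol (x 0).coords (x (0 + 1)).coords (p i).coords =
          s * vol (x 0).coords (x (0 + 1)).coords (x m).coords +
          t * vol (x 0).coords (x (0 + 1)).coords (x (m + 1)).coords := by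
        rw [hps]; simp only [vol, Pi.add_apply, Pi.smul_apply, smul_eq_mul]; ring
      rw [this]; positivity
    · have : vol (x 0).coords (p i).coords (x (m + 1)).coords =
          s * vol (x m).coords (x (m + 1)).coords (x 0).coords := by
        rw [hps]; simp only [vol, Pi.add_apply, Pi.smul_apply, smul_eq_mul]; ring
      rw [this]; positivity
    · rw [hx0, hx1, hxm]; exact hangle
  -- R is beyond `x m` as seen from `x (m + 1)`: a negative `1 - c * t` would put it inside the
  -- side, strictly to the left of the first edge, against `hvol`.
  have hY : ∃ r s : ℝ, 0 < r ∧ 0 ≤ s ∧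
      R.coords = r • (x m).coords + (-s) • (x (m + 1)).coords := by
    set c := -2 * lorentz (p i).coords (x (m + 1)).coords
    have hc : 0 < c := by simp only [c]; linarith
    have e : R.coords = (c * s) • (x m).coords + (-(1 - c * t)) • (x (m + 1)).coords := by
      rw [hR, hps]; module
    refine ⟨c * s, 1 - c * t, by positivity, ?_, e⟩
    have : vol (x 0).coords (x (0 + 1)).coords R.coords =
        c * s * vol (x 0).coords (x (0 + 1)).coords (x m).coords -
        (1 - c * t) * vol (x 0).coords (x (0 + 1)).coords (x (m + 1)).coords := by
      rw [e]; simp only [vol, Pi.add_apply, Pi.smul_apply, smul_eq_mul]; ring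
    rw [this] at hvol
    by_contra! hneg
    have := mul_neg_of_neg_of_pos hneg f2
    have := mul_pos (mul_pos hc hs) f1
    linarith
  have hchain := convex_chain_le (fun a c ha => hpos a c (by omega)) hseg m 0 R (by omega) hY hvol
  have d1 : hdist (x 0) R = hdist (x 0) (x (m + 1)) := by
    rw [hdist_eq_iff, hR, lorentz_add_smul_right, hright]; ring
  have d2 : hdist R (p i) = hdist (p i) (x (m + 1)) := by
    rw [hdist_comm, hdist_eq_iff, hR, lorentz_add_smul_right, lorentz_self]; ring
  have hsum : ∑ k ∈ Finset.range m, hdist (x (0 + k)) (x (0 + k + 1)) = chainLength v i m := by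
    refine Finset.sum_congr rfl fun k _ => ?_
    simp [hx, add_assoc]
  have hxm' : x m = v (i + m) := rfl
  rw [hsum, d1, d2, hx0, hxm, hxm'] at hchain
  have harcs := arcs_eq hv hp i
  -- The first edge of the other arc is split off, so that the triangle inequality is strict at its
  -- end.
  obtain ⟨k, rfl⟩ : ∃ k, m = 1 + k := ⟨m - 1, by omega⟩
  have h1 := chainLength_add v (i + (1 + k : ℕ) + 1) 1 k
  have h2 := hdist_le_chainLength v (i + (1 + k : ℕ) + 1 + 1) k
  have hend : i + (1 + k : ℕ) + 1 + 1 + (k : ZMod (2 * (1 + k) + 1)) = i := by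
    push_cast at hz ⊢
    linear_combination hz
  rw [hend] at h2
  rw [chainLength_one, Nat.cast_one] at h1
  have h3 := hdist_triangle_strict (x := v (i + (1 + k : ℕ) + 1))
    (y := v (i + (1 + k : ℕ) + 1 + 1)) (z := v i) (by
      have := hpos (1 + k + 1) 0 (by omega) (by omega) (by omega) (by omega)
      refine ne_of_gt ?_
      simpa [hx, add_assoc, one_add_one_eq_two] using this)
  rw [hdist_comm (v i)] at hchain
  linarith

end Odd

/-! ### The triangle -/

/-- The heights of a triangle are equal only if it is equilateral. -/
lemma angle_eq_angle_triangle {v p : ZMod (2 * 1 + 1) → H2} (hv : IsOrdinaryReduced (2 * 1 + 1) v)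
    (hp : ∀ i, IsFoot (p i) (v i) (oppLine (2 * 1 + 1) v i)) (i : ZMod (2 * 1 + 1)) :
    angle (p i) (v i) (v (i + 1 + 1)) = angle (v (i + 1)) (v i) (p i) := by
  have h3 : (3 : ZMod (2 * 1 + 1)) = 0 := by exact_mod_cast ZMod.natCast_self 3
  set a : ZMod (2 * 1 + 1) → ℝ := fun j => hdist (v j) (p (j + 1 + 1)) with ha
  have ha1 : ∀ j, a (j + 1) = hdist (v (j + 1)) (p j) := by
    intro j
    simp only [ha]
    rw [show j + 1 + 1 + 1 = j by linear_combination h3]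
  have hs : ∀ j, hdist (v j) (v (j + 1)) = a j + a (j + 2) := by
    intro j
    have h := hdist_side hv hp j
    rw [Nat.cast_one] at h
    rw [h, show j + 2 = j + 1 + 1 by ring, ha1]
  have hc : ∀ j, Real.cosh (hdist (v j) (v (j + 1))) =
      Real.cosh (hdist (v 0) (p 0)) * Real.cosh (a (j + 1)) := by
    intro j
    have h := (hp j).lorentz_eq (left_mem_oppLine v j)
    rw [Nat.cast_one] at h
    rw [ha1, cosh_hdist, cosh_hdist, cosh_hdist, h, height_eq hv hp j 0,
      lorentz_comm (v (j + 1)).coords]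
    ring
  have hmono : ∀ j k, hdist (v j) (v (j + 1)) ≤ hdist (v k) (v (k + 1)) ↔ a (j + 1) ≤ a (k + 1) := by
    intro j k
    have h0 := Real.cosh_pos (hdist (v 0) (p 0))
    rw [← abs_of_nonneg (hdist_nonneg (v j) _), ← abs_of_nonneg (hdist_nonneg (v k) _),
      ← Real.cosh_le_cosh, hc, hc, mul_le_mul_iff_right₀ h0, Real.cosh_le_cosh,
      abs_of_nonneg (hdist_nonneg _ _), abs_of_nonneg (hdist_nonneg _ _)]
  -- The successive sides are `a j + a (j + 2)` and `a (j + 1) + a j`, so their order is opposite to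
  -- the one given by `hmono`.
  have hstep : ∀ j, a (j + 1) = a (j + 2) := by
    intro j
    have h := hmono j (j + 1)
    rw [hs, hs, show j + 1 + 2 = j by linear_combination h3,
      show j + 1 + 1 = j + 2 by ring] at h
    rcases le_total (a (j + 1)) (a (j + 2)) with h' | h'
    · have := h.2 h'; linarith
    · have := h.1 (by linarith); linarith
  have hai : a i = a (i + 1) := by
    have h := hstep (i + 2)
    rwa [show i + 2 + 1 = i by linear_combination h3,
      show i + 2 + 2 = i + 1 by linear_combination h3] at h
  have hpq : lorentz (p i).coords (v (i + 1 + 1)).coords =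
      lorentz (p i).coords (v (i + 1)).coords := by
    have h := hdist_vertex_foot hv hp i
    rw [Nat.cast_one] at h
    rw [← hdist_eq_iff, ← h, hdist_comm, hdist_comm (p i), ← ha1, ← hai, hdist_comm]
  have h1 := (hp i).lorentz_eq (left_mem_oppLine v i)
  have h2 := (hp i).lorentz_eq (right_mem_oppLine v i)
  rw [Nat.cast_one] at h1 h2
  rw [angle_comm (v (i + 1)), angle_eq_arccos, angle_eq_arccos, hpq, h1, h2, hpq]

end HypPlane

theorem theorem2 (n : ℕ) (v : ZMod n → HypPlane.H2)
    (hv : HypPlane.IsOrdinaryReduced n v)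
    (p : ZMod n → HypPlane.H2)
    (hp : ∀ i, HypPlane.IsFoot (p i) (v i) (HypPlane.oppLine n v i)) :
    (∀ i, HypPlane.hdist (v i) (p (i + ((n + 1) / 2 : ℕ))) =
      HypPlane.hdist (p i) (v (i + ((n + 1) / 2 : ℕ)))) ∧
    (∀ i,
      HypPlane.chainLength v i ((n - 1) / 2) +
          HypPlane.hdist (v (i + ((n - 1) / 2 : ℕ))) (p i) =
        HypPlane.perimeter v / 2 ∧
      HypPlane.hdist (p i) (v (i + ((n + 1) / 2 : ℕ))) +
          HypPlane.chainLength v (i + ((n + 1) / 2 : ℕ)) ((n - 1) / 2) =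
        HypPlane.perimeter v / 2) ∧
    (n ≠ 3 → ∀ i,
      HypPlane.angle (p i) (v i) (v (i + ((n + 1) / 2 : ℕ))) <
        HypPlane.angle (v (i + 1)) (v i) (p i)) ∧
    (n = 3 → ∀ i,
      HypPlane.angle (p i) (v i) (v (i + ((n + 1) / 2 : ℕ))) =
        HypPlane.angle (v (i + 1)) (v i) (p i)) := by
  obtain ⟨m, rfl⟩ := hv.odd
  have e1 : (2 * m + 1 - 1) / 2 = m := by omega
  have e2 : (2 * m + 1 + 1) / 2 = m + 1 := by omega
  have hm := hv.convex.three_le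
  simp only [e1, e2, Nat.cast_succ, ← add_assoc]
  refine ⟨HypPlane.hdist_vertex_foot hv hp, fun i => ?_, fun h3 i => ?_, fun h3 i => ?_⟩
  · have h1 := HypPlane.arcs_eq hv hp i
    have h2 := HypPlane.arcs_add hv hp i
    constructor <;> linarith
  · exact HypPlane.angle_lt_angle hv hp (by omega) i
  · obtain rfl : m = 1 := by omega
    simpa using HypPlane.angle_eq_angle_triangle hv hp i
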